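/- A directed graph is a set of vertices with an irreflexive binary relation (so both $(u,v)$ and $(v,u)$ may be edges). Let $D$ be the countable universal directed graph, that is, the Fraïssé limit of the class of finite directed graphs, and let $\operatorname{End} D$ be its monoid of endomorphisms (maps $V(D)\to V(D)$ that preserve the edge relation). In a monoid $M$ write $f\,\mathscr{L}\,g$ if $Mf=Mg$ and $f\,\mathscr{R}\,g$ if $fM=gM$, and let $\mathscr{H}=\mathscr{L}\cap\mathscr{R}$ and $\mathscr{D}=\mathscr{L}\circ\mathscr{R}$. A $\mathscr{D}$-class is regular if it is the class of an element $f$ with $fgf=f$ for some $g\in M$, and a group $\mathscr{H}$-class is an $\mathscr{H}$-class that forms a group under the multiplication of $M$. **Theorem.** (i) Let $\Gamma$ be a countable (finite or infinite) undirected graph without loops or multiple edges. Then there are exactly $2^{\aleph_0}$ distinct regular $\mathscr{D}$-classes of $\operatorname{End} D$ all of whose group $\mathscr{H}$-classes are isomorphic to $\operatorname{Aut}\Gamma$. (ii) Every regular $\mathscr{D}$-class of $\operatorname{End} D$ contains exactly $2^{\aleph_0}$ distinct group $\mathscr{H}$-classes. -/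

import Mathlib

universe u v

/-! ### Green's relations on a monoid -/

section Green

variable {M : Type u} [Monoid M]

/-- `a` and `b` generate the same principal left ideal: `Ma = Mb`. -/
def GreenL (a b : M) : Prop :=
  Set.range (fun m : M => m * a) = Set.range (fun m : M => m * b)

/-- `a` and `b` generate the same principal right ideal: `aM = bM`. -/
def GreenR (a b : M) : Prop :=
  Set.range (fun m : M => a * m) = Set.range (fun m : M => b * m)

/-- Green's relation `H`, the intersection of `L` and `R`. -/
def GreenH (a b : M) : Prop :=
  GreenL a b ∧ GreenR a b

/-- Green's relation `D`, the composite of `L` and `R`. -/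
def GreenD (a b : M) : Prop :=
  ∃ c : M, GreenL a c ∧ GreenR c b

/-- `a` is a (von Neumann) regular element of the monoid. -/
def IsRegularElt (a : M) : Prop :=
  ∃ b : M, a * b * a = a

/-- The set `C` is the `D`-class of some regular element. -/
def IsRegularDClass (C : Set M) : Prop :=
  ∃ a : M, IsRegularElt a ∧ C = {b | GreenD a b}

/-- The set `H` is an `H`-class that forms a group under the multiplication of the monoid
(its identity element need not be that of the monoid). -/
structure IsGroupHClass (H : Set M) : Prop where
  isHClass : ∃ a : M, H = {b | GreenH a b}
  mul_mem : ∀ a ∈ H, ∀ b ∈ H, a * b ∈ H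
  exists_identity_inverse : ∃ e ∈ H, (∀ a ∈ H, e * a = a ∧ a * e = a) ∧
    ∀ a ∈ H, ∃ b ∈ H, a * b = e ∧ b * a = e

/-- The set `H`, with the multiplication inherited from the monoid, is isomorphic to the
group `G`. -/
def IsIsomorphicToGroup (H : Set M) (G : Type v) [Group G] : Prop :=
  ∃ φ : G ≃ H, ∀ x y : G, (φ (x * y) : M) = (φ x : M) * (φ y : M)

end Green

/-! ### Directed graphs -/

/-- A digraph as a structure for the first-order language with one binary relation symbol. -/
@[reducible]
def Digraph.toStructure {V : Type u} (D : Digraph V) :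
    FirstOrder.Language.graph.Structure V where
  RelMap | .adj => (fun x => D.Adj (x 0) (x 1))

/-- The class of finite directed graphs: finite sets with an irreflexive binary relation. -/
def finiteDirectedGraphs :
    Set (CategoryTheory.Bundled.{u} FirstOrder.Language.graph.Structure) :=
  {N | Finite N ∧ ∀ x : N, ¬ FirstOrder.Language.Structure.RelMap FirstOrder.Language.adj ![x, x]}

/-- `D` is (a copy of) the countable universal directed graph, that is, the Fraïssé limit of the
class of finite directed graphs. In particular the edge relation of `D` is irreflexive. -/
def Digraph.IsCountableUniversal {V : Type u} [Countable V] (D : Digraph V) : Prop :=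
  letI := D.toStructure
  FirstOrder.Language.IsFraisseLimit finiteDirectedGraphs.{u} V

/-- The endomorphism monoid of a digraph: maps on the vertices that preserve the edge relation,
under composition. The product `f * g` applies `g` first; reading products in the other order
interchanges `GreenL` and `GreenR` and leaves `H`-classes, `D`-classes, regularity, and the
isomorphism types of groups unchanged. -/
abbrev Digraph.End {V : Type u} (D : Digraph V) : Type u :=
  D.Adj →r D.Adj

/-! ### The extension property -/

namespace Digraph

/-! Everything is read off from idempotents. Every regular D-class contains an idempotent, and every
group H-class contains exactly one. An idempotent splits through the digraph induced on its image.
Two idempotents are D-related exactly when their images are isomorphic (`SplitsVia.greenD`,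
`SplitsVia.nonempty_relIso`), and the H-class of an idempotent is the automorphism group of its
image (`SplitsVia.isIsomorphicToGroup`). Up to isomorphism, the images are the countable loopless
algebraically closed digraphs: a retract inherits algebraic closedness from `D`, and a
back-and-forth construction gives the converse (`HasExtensionProperty.exists_retraction`).

Part (i) thus needs continuum many pairwise non-isomorphic such digraphs with automorphism group
`Aut Γ`; joining `Γ` completely to a rigid digraph on `ℕ` that codes a set `X` provides them
(`decoration`). For (ii), the image is enlarged by infinitely many vertices, each of which can be
folded onto either of two fixed vertices; the independent choices give continuum many idempotents.
The upper bounds hold because `D` has at most continuum many endomorphisms. -/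

/-- A digraph has the extension property if every configuration of edges between a new vertex
and a finite set of vertices is realised. -/
def HasExtensionProperty {V : Type*} (D : Digraph V) : Prop :=
  ∀ (F : Finset V) (P Q : V → Prop),
    ∃ v ∉ F, ∀ f ∈ F, (D.Adj v f ↔ P f) ∧ (D.Adj f v ↔ Q f)

/-- A digraph is algebraically closed if every finite set of vertices has a common neighbour,
joined to all of them in both directions. -/
def IsAlgClosed {V : Type*} (D : Digraph V) : Prop :=
  ∀ F : Finset V, ∃ v, ∀ f ∈ F, D.Adj v f ∧ D.Adj f v

/-- The one-point extension of the digraph induced on `F`, whose new vertex has an edge to the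
vertices in `P` and an edge from the vertices in `Q`. -/
def onePointExtension {V : Type*} (D : Digraph V) (F : Finset V) (P Q : V → Prop) :
    Digraph (Option F) where
  Adj
    | some a, some b => D.Adj a b
    | none, some b => P b
    | some a, none => Q a
    | none, none => False

theorem IsCountableUniversal.loopless {V : Type u} [Countable V] {D : Digraph V}
    (hD : D.IsCountableUniversal) (v : V) : ¬ D.Adj v v := by
  intro hv
  let _ := D.toStructure
  have hage := hD.age
  let S := FirstOrder.Language.Substructure.closure FirstOrder.Language.graph ({v} : Set V)
  have hS : (⟨S, inferInstance⟩ :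
      CategoryTheory.Bundled.{u} FirstOrder.Language.graph.Structure) ∈ finiteDirectedGraphs.{u} := by
    rw [← hage]
    exact ⟨(FirstOrder.Language.Substructure.fg_iff_structure_fg _).1
      (FirstOrder.Language.Substructure.fg_closure_singleton v), ⟨S.subtype⟩⟩
  refine hS.2 ⟨v, FirstOrder.Language.Substructure.subset_closure rfl⟩ ?_
  exact hv

/-- The one-point extension of `F` lies in the age, so ultrahomogeneity extends the inclusion of `F`
over it; the image of the new point is the required vertex. -/
theorem IsCountableUniversal.hasExtensionProperty {V : Type u} [Countable V] {D : Digraph V}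
    (hD : D.IsCountableUniversal) : D.HasExtensionProperty := by
  intro F P Q
  let _ := D.toStructure
  let E := D.onePointExtension F P Q
  let _ : FirstOrder.Language.graph.Structure (Option F) := E.toStructure
  let _ : FirstOrder.Language.graph.Structure F :=
    (Digraph.mk fun a b : F => D.Adj a b).toStructure
  have hE : (⟨Option F, inferInstance⟩ :
      CategoryTheory.Bundled.{u} FirstOrder.Language.graph.Structure) ∈ finiteDirectedGraphs.{u} := by
    refine ⟨inferInstanceAs (Finite (Option F)), ?_⟩
    rintro (_ | a)
    · exact id
    · exact hD.loopless a
  rw [← hD.age] at hE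
  obtain ⟨-, hE⟩ := hE
  have : Nonempty (FirstOrder.Language.Embedding FirstOrder.Language.graph (Option F) V) := hE
  let f : FirstOrder.Language.Embedding FirstOrder.Language.graph F V :=
    { toFun := Subtype.val
      inj' := Subtype.val_injective
      map_fun' := fun {n} φ => φ.elim
      map_rel' := fun {n} r x => by cases r; exact Iff.rfl }
  let g : FirstOrder.Language.Embedding FirstOrder.Language.graph F (Option F) :=
    { toFun := some
      inj' := Option.some_injective _
      map_fun' := fun {n} φ => φ.elim
      map_rel' := fun {n} r x => by cases r; exact Iff.rfl }
  have hF : FirstOrder.Language.Structure.FG FirstOrder.Language.graph F :=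
    FirstOrder.Language.Structure.FG.of_finite
  obtain ⟨f', hf'⟩ := hD.ultrahomogeneous.extend_embedding hF f g
  have hsome : ∀ a : F, f' (some a) = a := fun a =>
    (congrArg (fun k : FirstOrder.Language.Embedding FirstOrder.Language.graph F V => k a) hf').symm
  have hadj : ∀ a b : Option F, D.Adj (f' a) (f' b) ↔ E.Adj a b := fun a b =>
    f'.map_rel FirstOrder.Language.adj ![a, b]
  refine ⟨f' none, fun h => ?_, fun a ha => ?_⟩
  · have := f'.injective (hsome ⟨f' none, h⟩)
    cases this
  · have h1 := hadj none (some ⟨a, ha⟩)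
    have h2 := hadj (some ⟨a, ha⟩) none
    rw [hsome] at h1 h2
    exact ⟨h1, h2⟩

theorem HasExtensionProperty.isAlgClosed {V : Type*} {D : Digraph V}
    (hD : D.HasExtensionProperty) : D.IsAlgClosed := by
  intro F
  obtain ⟨v, -, hv⟩ := hD F (fun _ => True) (fun _ => True)
  exact ⟨v, fun f hf => ⟨(hv f hf).1.2 trivial, (hv f hf).2.2 trivial⟩⟩

/-! ### Algebraically closed digraphs are retracts -/

/-- Two entries `(v, a, m)` of a finite approximation to a retraction are compatible. Such an
entry says that `v` is mapped to `a`, and, if `m` holds, that `v` is the chosen preimage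
of `a`. -/
structure RetractCompat {V A : Type*} (D : Digraph V) (E : Digraph A)
    (p q : V × A × Bool) : Prop where
  eq_of_fst : p.1 = q.1 → p = q
  map_adj : D.Adj p.1 q.1 → E.Adj p.2.1 q.2.1
  eq_of_snd : p.2.2 → q.2.2 → p.2.1 = q.2.1 → p.1 = q.1
  adj_of_adj : p.2.2 → q.2.2 → E.Adj p.2.1 q.2.1 → D.Adj p.1 q.1

/-- Finite approximations to a retraction of `D` onto `E`. -/
def RetractApprox {V A : Type*} (D : Digraph V) (E : Digraph A) : Type _ :=
  {T : Finset (V × A × Bool) // ∀ p ∈ T, ∀ q ∈ T, RetractCompat D E p q}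

instance {V A : Type*} (D : Digraph V) (E : Digraph A) : Preorder (RetractApprox D E) :=
  inferInstanceAs (Preorder {T : Finset (V × A × Bool) //
    ∀ p ∈ T, ∀ q ∈ T, RetractCompat D E p q})

theorem RetractApprox.exists_insert {V A : Type*} {D : Digraph V} {E : Digraph A}
    (T : RetractApprox D E) (p : V × A × Bool) (hp : RetractCompat D E p p)
    (h : ∀ q ∈ T.1, RetractCompat D E p q ∧ RetractCompat D E q p) :
    ∃ T' : RetractApprox D E, T ≤ T' ∧ p ∈ T'.1 := by
  classical
  refine ⟨⟨insert p T.1, ?_⟩, Finset.subset_insert p T.1, Finset.mem_insert_self p T.1⟩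
  intro q hq r hr
  rw [Finset.mem_insert] at hq hr
  rcases hq with rfl | hq <;> rcases hr with rfl | hr
  · exact hp
  · exact (h r hr).1
  · exact (h q hq).2
  · exact T.2 q hq r hr

/-- Sending `v` to a common neighbour of all values used so far preserves whatever edges `v` has. -/
theorem RetractApprox.exists_mem_fst {V A : Type*} {D : Digraph V} {E : Digraph A}
    (hD : ∀ v, ¬ D.Adj v v) (hE : E.IsAlgClosed) (T : RetractApprox D E) (v : V) :
    ∃ T' : RetractApprox D E, T ≤ T' ∧ ∃ p ∈ T'.1, p.1 = v := by
  classical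
  by_cases hv : ∃ p ∈ T.1, p.1 = v
  · exact ⟨T, le_rfl, hv⟩
  push Not at hv
  obtain ⟨a, ha⟩ := hE (T.1.image fun p => p.2.1)
  obtain ⟨T', hT, hp⟩ := T.exists_insert (v, a, false)
    ⟨fun _ => rfl, fun h => (hD v h).elim, by simp, by simp⟩ (by
      intro q hq
      have hqa := ha q.2.1 (Finset.mem_image_of_mem _ hq)
      exact ⟨⟨fun h => (hv q hq h.symm).elim, fun _ => hqa.1, by simp, by simp⟩,
        ⟨fun h => (hv q hq h).elim, fun _ => hqa.2, by simp, by simp⟩⟩)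
  exact ⟨T', hT, _, hp, rfl⟩

/-- A fresh `v` is joined to the chosen preimages exactly as `a` is to their images, and to no other
vertex treated so far, so that no unwanted edge has to be preserved. -/
theorem RetractApprox.exists_mem_snd {V A : Type*} {D : Digraph V} {E : Digraph A}
    (hD : ∀ v, ¬ D.Adj v v) (hDE : D.HasExtensionProperty) (hE : ∀ a, ¬ E.Adj a a)
    (T : RetractApprox D E) (a : A) :
    ∃ T' : RetractApprox D E, T ≤ T' ∧ ∃ p ∈ T'.1, p.2.1 = a ∧ p.2.2 = true := by
  classical
  by_cases hv : ∃ p ∈ T.1, p.2.1 = a ∧ p.2.2 = true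
  · exact ⟨T, le_rfl, hv⟩
  push Not at hv
  obtain ⟨v, hvT, h⟩ := hDE (T.1.image fun p => p.1)
    (fun w => ∃ p ∈ T.1, p.1 = w ∧ p.2.2 = true ∧ E.Adj a p.2.1)
    (fun w => ∃ p ∈ T.1, p.1 = w ∧ p.2.2 = true ∧ E.Adj p.2.1 a)
  obtain ⟨T', hT, hp⟩ := T.exists_insert (v, a, true)
    ⟨fun _ => rfl, fun h => (hD v h).elim, fun _ _ _ => rfl, fun _ _ h => (hE a h).elim⟩ (by
      intro q hq
      have hqv := h q.1 (Finset.mem_image_of_mem _ hq)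
      have hne : q.1 ≠ v := fun h => hvT (h ▸ Finset.mem_image_of_mem _ hq)
      refine ⟨⟨fun h => (hne h.symm).elim, fun h => ?_, fun _ hb h => (hv q hq h.symm hb).elim,
        fun _ hb h => hqv.1.2 ⟨q, hq, rfl, hb, h⟩⟩, ⟨fun h => (hne h).elim, fun h => ?_,
        fun hb _ h => (hv q hq h hb).elim, fun hb _ h => hqv.2.2 ⟨q, hq, rfl, hb, h⟩⟩⟩
      · obtain ⟨p, hp, hpq, -, h'⟩ := hqv.1.1 h
        rwa [← (T.2 p hp q hq).eq_of_fst hpq]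
      · obtain ⟨p, hp, hpq, -, h'⟩ := hqv.2.1 h
        rwa [← (T.2 p hp q hq).eq_of_fst hpq])
  exact ⟨T', hT, _, hp, rfl, rfl⟩

/-- A countable loopless algebraically closed digraph is a retract of every countable loopless
digraph with the extension property. -/
theorem HasExtensionProperty.exists_retraction {V A : Type*} [Countable V] [Countable A]
    {D : Digraph V} {E : Digraph A} (hDE : D.HasExtensionProperty) (hD : ∀ v, ¬ D.Adj v v)
    (hE : E.IsAlgClosed) (hE' : ∀ a, ¬ E.Adj a a) :
    ∃ (i : E.Adj →r D.Adj) (r : D.Adj →r E.Adj), ∀ a, r (i a) = a := by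
  classical
  cases nonempty_encodable V
  cases nonempty_encodable A
  let 𝒟 : V ⊕ A → Order.Cofinal (RetractApprox D E)
    | .inl v => ⟨{T | ∃ p ∈ T.1, p.1 = v}, fun T => by
        obtain ⟨T', h, h'⟩ := T.exists_mem_fst hD hE v
        exact ⟨T', h', h⟩⟩
    | .inr a => ⟨{T | ∃ p ∈ T.1, p.2.1 = a ∧ p.2.2 = true}, fun T => by
        obtain ⟨T', h, h'⟩ := T.exists_mem_snd hD hDE hE' a
        exact ⟨T', h', h⟩⟩
  let T₀ : RetractApprox D E := ⟨∅, by simp⟩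
  -- The ideal meets each of the countably many requirements, so the union of its members is a map
  -- on all of `V` together with a chosen preimage of every `a`.
  let I := Order.idealOfCofinals T₀ 𝒟
  let S : Set (V × A × Bool) := {p | ∃ T ∈ I, p ∈ T.1}
  have hS : ∀ p ∈ S, ∀ q ∈ S, RetractCompat D E p q := by
    rintro p ⟨T, hT, hp⟩ q ⟨T', hT', hq⟩
    obtain ⟨U, -, hU, hU'⟩ := I.directed T hT T' hT'
    exact U.2 p (hU hp) q (hU' hq)
  have h1 : ∀ v, ∃ p ∈ S, p.1 = v := fun v => by
    obtain ⟨T, ⟨p, hp, h⟩, hT⟩ := Order.cofinal_meets_idealOfCofinals T₀ 𝒟 (.inl v)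
    exact ⟨p, ⟨T, hT, hp⟩, h⟩
  have h2 : ∀ a, ∃ p ∈ S, p.2.1 = a ∧ p.2.2 = true := fun a => by
    obtain ⟨T, ⟨p, hp, h⟩, hT⟩ := Order.cofinal_meets_idealOfCofinals T₀ 𝒟 (.inr a)
    exact ⟨p, ⟨T, hT, hp⟩, h⟩
  choose r hr hr1 using h1
  choose i hi hi1 hi2 using h2
  refine ⟨⟨fun a => (i a).1, fun {a b} h => ?_⟩, ⟨fun v => (r v).2.1, fun {v w} h => ?_⟩,
    fun a => ?_⟩
  · exact (hS _ (hi a) _ (hi b)).adj_of_adj (hi2 a) (hi2 b) (by rwa [hi1, hi1])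
  · exact (hS _ (hr v) _ (hr w)).map_adj (by rwa [hr1, hr1])
  · have := (hS _ (hr (i a).1) _ (hi a)).eq_of_fst (hr1 _)
    change (r (i a).1).2.1 = a
    rw [this, hi1]

end Digraph

/-! ### Green's relations and idempotents -/

section GreenLemmas

variable {M : Type u} [Monoid M]

theorem greenL_iff {a b : M} : GreenL a b ↔ (∃ x, a = x * b) ∧ ∃ y, b = y * a := by
  constructor
  · intro h
    have h1 : a ∈ Set.range (fun m : M => m * b) := h ▸ ⟨1, one_mul a⟩
    have h2 : b ∈ Set.range (fun m : M => m * a) := h.symm ▸ ⟨1, one_mul b⟩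
    exact ⟨h1.imp fun _ => Eq.symm, h2.imp fun _ => Eq.symm⟩
  · rintro ⟨⟨x, hx⟩, y, hy⟩
    apply Set.Subset.antisymm
    · rintro _ ⟨m, rfl⟩
      exact ⟨m * x, by simp only [mul_assoc, ← hx]⟩
    · rintro _ ⟨m, rfl⟩
      exact ⟨m * y, by simp only [mul_assoc, ← hy]⟩

theorem greenR_iff {a b : M} : GreenR a b ↔ (∃ x, a = b * x) ∧ ∃ y, b = a * y := by
  constructor
  · intro h
    have h1 : a ∈ Set.range (fun m : M => b * m) := h ▸ ⟨1, mul_one a⟩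
    have h2 : b ∈ Set.range (fun m : M => a * m) := h.symm ▸ ⟨1, mul_one b⟩
    exact ⟨h1.imp fun _ => Eq.symm, h2.imp fun _ => Eq.symm⟩
  · rintro ⟨⟨x, hx⟩, y, hy⟩
    apply Set.Subset.antisymm
    · rintro _ ⟨m, rfl⟩
      exact ⟨x * m, by simp only [← mul_assoc, ← hx]⟩
    · rintro _ ⟨m, rfl⟩
      exact ⟨y * m, by simp only [← mul_assoc, ← hy]⟩

theorem GreenH.refl (a : M) : GreenH a a := ⟨rfl, rfl⟩

theorem GreenH.symm {a b : M} (h : GreenH a b) : GreenH b a := ⟨Eq.symm h.1, Eq.symm h.2⟩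

theorem GreenH.trans {a b c : M} (h : GreenH a b) (h' : GreenH b c) : GreenH a c :=
  ⟨Eq.trans h.1 h'.1, Eq.trans h.2 h'.2⟩

theorem GreenH.setOf_eq {a b : M} (h : GreenH a b) : {x | GreenH a x} = {x | GreenH b x} :=
  Set.ext fun _ => ⟨h.symm.trans, h.trans⟩

theorem GreenD.refl (a : M) : GreenD a a := ⟨a, rfl, rfl⟩

theorem GreenD.of_greenL_left {a b c : M} (h : GreenL a b) : GreenD a c → GreenD b c :=
  fun ⟨d, hd, hd'⟩ => ⟨d, Eq.trans (Eq.symm h) hd, hd'⟩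

theorem GreenD.trans_greenR {a b c : M} (h : GreenD a b) (h' : GreenR b c) : GreenD a c :=
  h.imp fun _ hd => ⟨hd.1, Eq.trans hd.2 h'⟩

/-- Idempotents in the same `H`-class are equal. -/
theorem GreenH.eq_of_isIdempotentElem {e f : M} (h : GreenH e f) (he : IsIdempotentElem e)
    (hf : IsIdempotentElem f) : e = f := by
  obtain ⟨⟨⟨x, hx⟩, -⟩, -, y, hy⟩ := And.intro (greenL_iff.1 h.1) (greenR_iff.1 h.2)
  have h1 : e * f = e := by rw [hx, mul_assoc, hf]
  have h2 : e * f = f := by rw [hy, ← mul_assoc, he]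
  exact h1.symm.trans h2

theorem IsIdempotentElem.isRegularElt {e : M} (he : IsIdempotentElem e) : IsRegularElt e :=
  ⟨1, by rw [mul_one, he]⟩

/-- Every regular `D`-class is the class of an idempotent. -/
theorem IsRegularDClass.exists_isIdempotentElem {C : Set M} (hC : IsRegularDClass C) :
    ∃ e : M, IsIdempotentElem e ∧ C = {b | GreenD e b} := by
  obtain ⟨a, ⟨b, hb⟩, rfl⟩ := hC
  have h : GreenL a (b * a) :=
    greenL_iff.2 ⟨⟨a, by rw [← mul_assoc, hb]⟩, b, rfl⟩
  refine ⟨b * a, ?_, Set.ext fun _ => ⟨.of_greenL_left h, .of_greenL_left (Eq.symm h)⟩⟩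
  rw [IsIdempotentElem, mul_assoc, ← mul_assoc a b a, hb]

/-- Every group `H`-class is the class of an idempotent. -/
theorem IsGroupHClass.exists_isIdempotentElem {H : Set M} (hH : IsGroupHClass H) :
    ∃ e : M, e ∈ H ∧ IsIdempotentElem e ∧ H = {b | GreenH e b} := by
  obtain ⟨a, rfl⟩ := hH.isHClass
  obtain ⟨e, he, h, -⟩ := hH.exists_identity_inverse
  exact ⟨e, he, (h e he).1, GreenH.setOf_eq he⟩

/-- A multiplicative copy of a group that is an `H`-class is a group `H`-class. -/
theorem IsIsomorphicToGroup.isGroupHClass {H : Set M} {G : Type v} [Group G]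
    (h : IsIsomorphicToGroup H G) (hH : ∃ a : M, H = {b | GreenH a b}) : IsGroupHClass H := by
  obtain ⟨φ, hφ⟩ := h
  have key : ∀ a ∈ H, ∃ g, (φ g : M) = a := fun a ha => ⟨φ.symm ⟨a, ha⟩, by simp⟩
  refine ⟨hH, fun a ha b hb => ?_, φ 1, (φ 1).2, fun a ha => ?_, fun a ha => ?_⟩
  · obtain ⟨g, rfl⟩ := key a ha
    obtain ⟨g', rfl⟩ := key b hb
    rw [← hφ]
    exact Subtype.coe_prop _
  · obtain ⟨g, rfl⟩ := key a ha
    rw [← hφ, ← hφ, one_mul, mul_one]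
    exact ⟨rfl, rfl⟩
  · obtain ⟨g, rfl⟩ := key a ha
    refine ⟨φ g⁻¹, Subtype.coe_prop _, ?_⟩
    rw [← hφ, ← hφ, mul_inv_cancel, inv_mul_cancel]
    exact ⟨rfl, rfl⟩

end GreenLemmas

/-! ### Splittings of idempotent endomorphisms -/

namespace Digraph

variable {V A B : Type*} {D : Digraph V} {E : Digraph A} {E' : Digraph B}

/-- The endomorphism `e` factors as a retraction onto `E` followed by a section of it. -/
def SplitsVia (e : D.End) (E : Digraph A) : Prop :=
  ∃ (i : E.Adj →r D.Adj) (r : D.Adj →r E.Adj), (∀ a, r (i a) = a) ∧ ∀ v, e v = i (r v)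

theorem SplitsVia.isIdempotentElem {e : D.End} (h : SplitsVia e E) : IsIdempotentElem e := by
  obtain ⟨i, r, hir, he⟩ := h
  refine RelHom.ext fun v => ?_
  change e (e v) = e v
  rw [he v, he, hir]

/-- The subdigraph induced on the image of `e`. -/
def image (e : D.End) : Digraph (Set.range e) where
  Adj a b := D.Adj a b

theorem splitsVia_image {e : D.End} (he : IsIdempotentElem e) : SplitsVia e (image e) := by
  refine ⟨⟨Subtype.val, id⟩, ⟨fun v => ⟨e v, v, rfl⟩, e.map_rel⟩, ?_, fun v => rfl⟩
  rintro ⟨_, v, rfl⟩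
  exact Subtype.ext (DFunLike.congr_fun he v)

theorem SplitsVia.of_relIso {e : D.End} (h : SplitsVia e E) (θ : E.Adj ≃r E'.Adj) :
    SplitsVia e E' := by
  obtain ⟨i, r, hir, he⟩ := h
  refine ⟨i.comp θ.symm.toRelEmbedding.toRelHom, θ.toRelEmbedding.toRelHom.comp r,
    fun a => ?_, fun v => ?_⟩
  · change θ (r (i (θ.symm a))) = a
    simp [hir]
  · change e v = i (θ.symm (θ (r v)))
    simp [he]

/-- A relation isomorphism from two mutually inverse homomorphisms. -/
def relIsoOfHoms (f : E.Adj →r E'.Adj) (g : E'.Adj →r E.Adj) (hgf : ∀ a, g (f a) = a)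
    (hfg : ∀ b, f (g b) = b) : E.Adj ≃r E'.Adj where
  toFun := f
  invFun := g
  left_inv := hgf
  right_inv := hfg
  map_rel_iff' {a b} := ⟨fun h => by simpa [hgf] using g.map_rel h, f.map_rel⟩

theorem SplitsVia.greenD {e f : D.End} (he : SplitsVia e E) (hf : SplitsVia f E) :
    GreenD e f := by
  obtain ⟨i, r, hir, he⟩ := he
  obtain ⟨j, s, hjs, hf⟩ := hf
  -- `j ∘ r` has the kernel of `e` and the image of `f`.
  refine ⟨j.comp r, greenL_iff.2 ⟨⟨i.comp s, ?_⟩, j.comp r, ?_⟩,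
    greenR_iff.2 ⟨⟨j.comp r, ?_⟩, i.comp s, ?_⟩⟩ <;> refine RelHom.ext fun v => ?_
  · change e v = i (s (j (r v)))
    rw [he, hjs]
  · change j (r v) = j (r (e v))
    rw [he, hir]
  · change j (r v) = f (j (r v))
    rw [hf, hjs]
  · change f v = j (r (i (s v)))
    rw [hf, hir]

/-- With `e L c R f`, the map `s ∘ c ∘ i` has left inverse `r ∘ y ∘ j` and right inverse `r ∘ w ∘
j`, which therefore coincide. -/
theorem SplitsVia.nonempty_relIso {e f : D.End} (he : SplitsVia e E) (hf : SplitsVia f E')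
    (h : GreenD e f) : Nonempty (E.Adj ≃r E'.Adj) := by
  have hee := he.isIdempotentElem
  have hff := hf.isIdempotentElem
  obtain ⟨i, r, hir, he⟩ := he
  obtain ⟨j, s, hjs, hf⟩ := hf
  obtain ⟨c, hL, hR⟩ := h
  obtain ⟨⟨y, hy⟩, x, hx⟩ := greenL_iff.1 hL
  obtain ⟨⟨z, hz⟩, w, hw⟩ := greenR_iff.1 hR
  have hce : c * e = c := by rw [hx, mul_assoc, hee]
  have hfc : f * c = c := by rw [hz, ← mul_assoc, hff]
  have hjsc : ∀ v, j (s (c v)) = c v := fun v => by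
    rw [← hf]
    exact DFunLike.congr_fun hfc v
  have hcir : ∀ v, c (i (r v)) = c v := fun v => by
    rw [← he]
    exact DFunLike.congr_fun hce v
  refine ⟨relIsoOfHoms (s.comp (c.comp i)) (r.comp ((y : D.Adj →r D.Adj).comp j))
    (fun a => ?_) fun b => ?_⟩
  · change r (y (j (s (c (i a))))) = a
    have : e (i a) = y (c (i a)) := DFunLike.congr_fun hy (i a)
    rw [hjsc, ← this, he, hir, hir]
  · have h' : s (c (i (r (w (j b))))) = b := by
      have : f (j b) = c (w (j b)) := DFunLike.congr_fun hw (j b)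
      rw [hcir, ← this, hf, hjs, hjs]
    have hinj : r (y (j b)) = r (w (j b)) := by
      have h1 : j b = c (i (r (w (j b)))) := by rw [← hjsc, h']
      have : e (i (r (w (j b)))) = y (c (i (r (w (j b))))) := DFunLike.congr_fun hy _
      rw [h1, ← this, he, hir, hir, ← h1]
    change s (c (i (r (y (j b))))) = b
    rw [hinj, h']

/-- The `H`-class of a split idempotent is isomorphic to the automorphism group of the digraph
through which it splits. -/
theorem SplitsVia.isIsomorphicToGroup {e : D.End} (h : SplitsVia e E) :
    IsIsomorphicToGroup {b | GreenH e b} (E.Adj ≃r E.Adj) := by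
  have hee := h.isIdempotentElem
  obtain ⟨i, r, hir, he⟩ := h
  let ψ (σ : E.Adj ≃r E.Adj) : D.End := i.comp (σ.toRelEmbedding.toRelHom.comp r)
  have hψ : ∀ σ v, ψ σ v = i (σ (r v)) := fun σ v => rfl
  have hmul : ∀ σ τ, ψ (σ * τ) = ψ σ * ψ τ := fun σ τ => RelHom.ext fun v => by
    change i (σ (τ (r v))) = i (σ (r (i (τ (r v)))))
    rw [hir]
  have hone : ψ 1 = e := RelHom.ext fun v => (he v).symm
  have hmem : ∀ σ, GreenH e (ψ σ) := fun σ =>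
    ⟨greenL_iff.2 ⟨⟨ψ σ⁻¹, by rw [← hmul, inv_mul_cancel, hone]⟩, ψ σ, by
        rw [← hone, ← hmul, mul_one]⟩,
      greenR_iff.2 ⟨⟨ψ σ⁻¹, by rw [← hmul, mul_inv_cancel, hone]⟩, ψ σ, by
        rw [← hone, ← hmul, one_mul]⟩⟩
  refine ⟨Equiv.ofBijective (fun σ => ⟨ψ σ, hmem σ⟩) ⟨fun σ τ hστ => ?_, ?_⟩, hmul⟩
  · refine RelIso.ext fun a => ?_
    have h := congrArg r (DFunLike.congr_fun (congrArg Subtype.val hστ) (i a))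
    change r (i (σ (r (i a)))) = r (i (τ (r (i a)))) at h
    simpa only [hir] using h
  · rintro ⟨b, hb⟩
    obtain ⟨⟨x, hx⟩, y, hy⟩ := greenL_iff.1 hb.1
    obtain ⟨⟨z, hz⟩, w, hw⟩ := greenR_iff.1 hb.2
    have hbe : b * e = b := by rw [hy, mul_assoc, hee]
    have heb : e * b = b := by rw [hw, ← mul_assoc, hee]
    have hirb : ∀ v, i (r (b v)) = b v := fun v => by
      rw [← he]
      exact DFunLike.congr_fun heb v
    have hbir : ∀ v, b (i (r v)) = b v := fun v => by
      rw [← he]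
      exact DFunLike.congr_fun hbe v
    have hl : ∀ a, r (x (i (r (b (i a))))) = a := fun a => by
      have : e (i a) = x (b (i a)) := DFunLike.congr_fun hx (i a)
      rw [hirb, ← this, he, hir, hir]
    have hr : ∀ a, r (b (i (r (z (i a))))) = a := fun a => by
      have : e (i a) = b (z (i a)) := DFunLike.congr_fun hz (i a)
      rw [hbir, ← this, he, hir, hir]
    -- A left and a right inverse of `r ∘ b ∘ i` agree.
    have hxz : ∀ a, r (x (i a)) = r (z (i a)) := fun a => by
      conv_lhs => rw [← hr a, hl]
    refine ⟨relIsoOfHoms (r.comp ((b : D.Adj →r D.Adj).comp i))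
      (r.comp ((x : D.Adj →r D.Adj).comp i)) hl fun a => ?_, Subtype.ext (RelHom.ext fun v => ?_)⟩
    · change r (b (i (r (x (i a))))) = a
      rw [hxz, hr]
    · change i (r (b (i (r v)))) = b v
      rw [hirb, hbir]

theorem SplitsVia.isGroupHClass {e : D.End} (h : SplitsVia e E) :
    IsGroupHClass {b | GreenH e b} :=
  h.isIsomorphicToGroup.isGroupHClass ⟨e, rfl⟩

/-- The retraction carries a common neighbour of the lifted set to one of the original set. -/
theorem SplitsVia.isAlgClosed {e : D.End} (h : SplitsVia e E) (hD : D.IsAlgClosed) :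
    E.IsAlgClosed := by
  classical
  obtain ⟨i, r, hir, -⟩ := h
  intro F
  obtain ⟨v, hv⟩ := hD (F.image i)
  refine ⟨r v, fun f hf => ?_⟩
  have := hv (i f) (Finset.mem_image_of_mem i hf)
  have h1 := r.map_rel this.1
  have h2 := r.map_rel this.2
  rw [hir] at h1 h2
  exact ⟨h1, h2⟩

end Digraph

theorem IsIsomorphicToGroup.congr {M : Type u} [Monoid M] {H : Set M} {G G' : Type*} [Group G]
    [Group G'] (h : IsIsomorphicToGroup H G) (e : G' ≃* G) : IsIsomorphicToGroup H G' := by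
  obtain ⟨φ, hφ⟩ := h
  exact ⟨e.toEquiv.trans φ, fun x y => by simp [hφ]⟩

namespace Digraph

/-! ### Continuum many idempotents splitting through the same digraph -/

/-- The digraph `E` with countably many additional vertices, pairwise non-adjacent and joined in
both directions to the common neighbours of `a₀` and `a₁`. -/
def addTwins {A : Type*} (E : Digraph A) (a : Bool → A) : Digraph (A ⊕ ℕ) where
  Adj
    | .inl x, .inl y => E.Adj x y
    | .inl x, .inr _ => ∀ b, E.Adj x (a b) ∧ E.Adj (a b) x
    | .inr _, .inl y => ∀ b, E.Adj y (a b) ∧ E.Adj (a b) y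
    | .inr _, .inr _ => False

theorem IsAlgClosed.addTwins {A : Type*} {E : Digraph A} (hE : E.IsAlgClosed) (a : Bool → A) :
    (E.addTwins a).IsAlgClosed := by
  classical
  intro F
  obtain ⟨v, hv⟩ := hE (F.toLeft ∪ Finset.univ.image a)
  refine ⟨.inl v, ?_⟩
  have ha : ∀ b, E.Adj v (a b) ∧ E.Adj (a b) v := fun b =>
    hv _ (Finset.mem_union_right _ (Finset.mem_image_of_mem a (Finset.mem_univ b)))
  rintro (x | n) hx
  · exact hv x (by simp [hx])
  · exact ⟨ha, ha⟩

theorem IsAlgClosed.exists_ne {A : Type*} {E : Digraph A} (hE : E.IsAlgClosed)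
    (hE' : ∀ a, ¬ E.Adj a a) : ∃ a b : A, a ≠ b := by
  obtain ⟨a, -⟩ := hE ∅
  obtain ⟨b, hb⟩ := hE {a}
  refine ⟨a, b, ?_⟩
  rintro rfl
  exact hE' a (hb a (by simp)).1

/-- A twin is joined only to vertices joined to both `a₀` and `a₁`, so each twin may be folded onto
either one independently. The value of the endomorphism at the `n`th twin reveals `x n`. -/
theorem exists_injective_splitsVia {V A : Type*} [Countable V] [Countable A] {D : Digraph V}
    {E : Digraph A} (hDE : D.HasExtensionProperty) (hD : ∀ v, ¬ D.Adj v v)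
    (hE : E.IsAlgClosed) (hE' : ∀ a, ¬ E.Adj a a) :
    ∃ e : (ℕ → Bool) → D.End, Function.Injective e ∧ ∀ x, SplitsVia (e x) E := by
  obtain ⟨a₀, a₁, hne⟩ := hE.exists_ne hE'
  let a : Bool → A := fun b => cond b a₀ a₁
  have ha : Function.Injective a := by
    rintro (_ | _) (_ | _) h
    exacts [rfl, (hne h.symm).elim, (hne h).elim, rfl]
  obtain ⟨i, r, hir⟩ := hDE.exists_retraction hD (hE.addTwins a) (by
    rintro (x | n)
    · exact hE' x
    · exact id)
  let j : E.Adj →r (E.addTwins a).Adj := ⟨Sum.inl, id⟩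
  let ρ (x : ℕ → Bool) : (E.addTwins a).Adj →r E.Adj :=
    ⟨Sum.elim id fun n => a (x n), by
      rintro (y | m) (z | n) h
      · exact h
      · exact (h (x n)).1
      · exact (h (x m)).2
      · exact h.elim⟩
  refine ⟨fun x => i.comp (j.comp ((ρ x).comp r)), fun x y h => funext fun n => ?_,
    fun x => ⟨i.comp j, (ρ x).comp r, fun b => ?_, fun v => rfl⟩⟩
  · have h' : i (j (ρ x (r (i (.inr n))))) = i (j (ρ y (r (i (.inr n))))) :=
      DFunLike.congr_fun h (i (.inr n))
    have h'' := congrArg r h'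
    simp only [hir] at h''
    exact ha (Sum.inl_injective h'')
  · change ρ x (r (i (.inl b))) = b
    rw [hir]
    rfl

/-! ### Rigid decorations of a graph -/

/-- The digraph on `W ⊕ ℕ` that is `Γ` on `W`, joins the vertices in different summands in both
directions, and on `ℕ` joins distinct vertices in both directions, except that there is no edge
from `n + 1` to `n` and that `n` and `n + 2` are not adjacent if `n ∈ X`. -/
def decoration {W : Type*} (Γ : SimpleGraph W) (X : Set ℕ) : Digraph (W ⊕ ℕ) where
  Adj
    | .inl x, .inl y => Γ.Adj x y
    | .inl _, .inr _ => True
    | .inr _, .inl _ => True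
    | .inr m, .inr n => m ≠ n ∧ m ≠ n + 1 ∧ ¬ (n = m + 2 ∧ m ∈ X) ∧ ¬ (m = n + 2 ∧ n ∈ X)

section Decoration

variable {W : Type*} {Γ : SimpleGraph W} {X Y : Set ℕ}

theorem decoration_loopless (a : W ⊕ ℕ) : ¬ (decoration Γ X).Adj a a := by
  rcases a with x | n
  · exact Γ.irrefl
  · exact fun h => h.1 rfl

theorem decoration_isAlgClosed : (decoration Γ X).IsAlgClosed := by
  intro F
  -- Missing edges within `ℕ` only concern numbers at distance at most 2.
  refine ⟨.inr (F.toRight.sup id + 3), ?_⟩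
  rintro (x | n) hx
  · exact ⟨trivial, trivial⟩
  · have hn : n ≤ F.toRight.sup id := Finset.le_sup (f := id) (Finset.mem_toRight.2 hx)
    refine ⟨⟨?_, ?_, ?_, ?_⟩, ⟨?_, ?_, ?_, ?_⟩⟩ <;> omega

/-- There is an edge from `a` to `b` but not from `b` to `a`. -/
def OneWay {A : Type*} (E : Digraph A) (a b : A) : Prop :=
  E.Adj a b ∧ ¬ E.Adj b a

theorem oneWay_decoration_iff {a b : W ⊕ ℕ} :
    (decoration Γ X).OneWay a b ↔ ∃ n, a = .inr n ∧ b = .inr (n + 1) := by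
  constructor
  · rintro ⟨h, h'⟩
    rcases a with x | m <;> rcases b with y | n
    · exact (h' (Γ.adj_symm h)).elim
    · exact (h' trivial).elim
    · exact (h' trivial).elim
    · refine ⟨m, rfl, congrArg _ ?_⟩
      by_contra hne
      exact h' ⟨h.1.symm, hne, h.2.2.2, h.2.2.1⟩
  · rintro ⟨n, rfl, rfl⟩
    exact ⟨⟨by omega, by omega, by omega, by omega⟩, fun h => h.2.1 rfl⟩

theorem oneWay_relIso {A B : Type*} {E : Digraph A} {E' : Digraph B} (θ : E.Adj ≃r E'.Adj)
    {a b : A} : E'.OneWay (θ a) (θ b) ↔ E.OneWay a b := by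
  simp only [OneWay, θ.map_rel_iff]

/-- The one-way edges form the ray `0 → 1 → 2 → ⋯`, which is rigid: no one-way edge enters its
origin. -/
theorem decoration_relIso_inr (θ : (decoration Γ X).Adj ≃r (decoration Γ Y).Adj) (n : ℕ) :
    θ (.inr n) = .inr n := by
  have step : ∀ n, ∃ m, θ (.inr n) = .inr m ∧ θ (.inr (n + 1)) = .inr (m + 1) := fun n =>
    oneWay_decoration_iff.1 ((oneWay_relIso θ).2 (oneWay_decoration_iff.2 ⟨n, rfl, rfl⟩))
  induction n with
  | zero =>
    obtain ⟨m, hm, -⟩ := step 0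
    rcases m with _ | m
    · exact hm
    · exfalso
      have h : (decoration Γ Y).OneWay (θ (θ.symm (.inr m))) (θ (.inr 0)) := by
        rw [hm, θ.apply_symm_apply]
        exact oneWay_decoration_iff.2 ⟨m, rfl, rfl⟩
      obtain ⟨k, -, hk⟩ := oneWay_decoration_iff.1 ((oneWay_relIso θ).1 h)
      exact absurd (Sum.inr_injective hk) (by omega)
  | succ n ih =>
    obtain ⟨m, hm, hm'⟩ := step n
    rw [hm']
    rw [hm] at ih
    rw [Sum.inr_injective ih]

theorem decoration_relIso_inl (θ : (decoration Γ X).Adj ≃r (decoration Γ Y).Adj) (x : W) :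
    ∃ y, θ (.inl x) = .inl y := by
  rcases h : θ (.inl x) with y | n
  · exact ⟨y, rfl⟩
  · rw [← decoration_relIso_inr θ n] at h
    exact absurd (θ.injective h) (by simp)

theorem eq_of_decoration_relIso (θ : (decoration Γ X).Adj ≃r (decoration Γ Y).Adj) : X = Y := by
  have key : ∀ Z : Set ℕ, ∀ n, n ∈ Z ↔ ¬ (decoration Γ Z).Adj (.inr n) (.inr (n + 2)) := by
    intro Z n
    refine ⟨fun hn h => h.2.2.1 ⟨rfl, hn⟩, fun h => ?_⟩
    by_contra hn
    exact h ⟨by omega, by omega, fun h => hn h.2, by omega⟩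
  ext n
  rw [key, key, ← θ.map_rel_iff, decoration_relIso_inr, decoration_relIso_inr]

/-- The automorphism of the decoration induced by an automorphism of the graph. -/
def decorationMap (X : Set ℕ) (σ : Γ ≃g Γ) : (decoration Γ X).Adj ≃r (decoration Γ X).Adj where
  toEquiv := Equiv.sumCongr σ.toEquiv (Equiv.refl ℕ)
  map_rel_iff' {a b} := by
    rcases a with x | m <;> rcases b with y | n
    · exact σ.map_rel_iff
    · exact Iff.rfl
    · exact Iff.rfl
    · exact Iff.rfl

/-- The automorphism groups of a graph and of its decorations are isomorphic. -/
noncomputable def decorationAut (Γ : SimpleGraph W) (X : Set ℕ) :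
    (Γ ≃g Γ) ≃* ((decoration Γ X).Adj ≃r (decoration Γ X).Adj) :=
  MulEquiv.ofBijective
    ({ toFun := decorationMap X
       map_one' := RelIso.ext fun a => by rcases a with x | n <;> rfl
       map_mul' := fun σ τ => RelIso.ext fun a => by rcases a with x | n <;> rfl } :
      (Γ ≃g Γ) →* ((decoration Γ X).Adj ≃r (decoration Γ X).Adj)) <| by
    constructor
    · intro σ τ h
      exact RelIso.ext fun x => Sum.inl_injective (DFunLike.congr_fun h (.inl x))
    · intro θ
      choose f hf using decoration_relIso_inl θ
      choose g hg using decoration_relIso_inl θ.symm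
      refine ⟨⟨⟨f, g, fun x => ?_, fun x => ?_⟩, fun {x y} => ?_⟩, RelIso.ext fun a => ?_⟩
      · apply Sum.inl_injective (β := ℕ)
        rw [← hg, ← hf, θ.symm_apply_apply]
      · apply Sum.inl_injective (β := ℕ)
        rw [← hf, ← hg, θ.apply_symm_apply]
      · have := θ.map_rel_iff (a := .inl x) (b := .inl y)
        rw [hf, hf] at this
        exact this
      · rcases a with x | n
        · exact (hf x).symm
        · exact (decoration_relIso_inr θ n).symm

end Decoration

/-! ### Counting -/

theorem mk_eq_continuum {V : Type u} [Countable V] {D : Digraph V} {β : Type u}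
    (f : (ℕ → Bool) → β) (hf : Function.Injective f) (g : β → D.End)
    (hg : Function.Injective g) : Cardinal.mk β = Cardinal.continuum := by
  apply le_antisymm
  · calc Cardinal.mk β ≤ Cardinal.mk (V → V) :=
          Cardinal.mk_le_of_injective (DFunLike.coe_injective.comp hg)
      _ ≤ Cardinal.aleph0 ^ Cardinal.aleph0 := by
          rw [← Cardinal.power_def]
          -- Enlarging the exponent needs a nonzero base, since `0 ^ 0 = 1`.
          by_cases hV : Cardinal.mk V = 0
          · rw [hV, Cardinal.power_zero, Cardinal.aleph0_power_aleph0]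
            exact Cardinal.nat_lt_continuum 1 |>.le.trans' (by simp)
          · exact (Cardinal.power_le_power_left hV Cardinal.mk_le_aleph0).trans
              (Cardinal.power_le_power_right Cardinal.mk_le_aleph0)
      _ = Cardinal.continuum := Cardinal.aleph0_power_aleph0
  · have h := Cardinal.mk_le_of_injective
      (f := fun x : ULift.{u} (ℕ → Bool) => f x.down) (hf.comp ULift.down_injective)
    simpa using h

end Digraph

open Digraph in
theorem mainTheorem7 {V : Type u} [Countable V] (D : Digraph V) (hD : D.IsCountableUniversal) :
    (∀ {W : Type v} [Countable W] (Γ : SimpleGraph W),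
      Cardinal.mk {C : Set D.End // IsRegularDClass C ∧
        ∀ H : Set D.End, H ⊆ C → IsGroupHClass H → IsIsomorphicToGroup H (Γ ≃g Γ)} =
      Cardinal.continuum) ∧
    (∀ C : Set D.End, IsRegularDClass C →
      Cardinal.mk {H : Set D.End // IsGroupHClass H ∧ H ⊆ C} = Cardinal.continuum) := by
  have hDE := hD.hasExtensionProperty
  have hDl := hD.loopless
  constructor
  · intro W _ Γ
    have hex : ∀ X : Set ℕ, ∃ e : D.End, SplitsVia e (decoration Γ X) := fun X => by
      obtain ⟨e, -, he⟩ := exists_injective_splitsVia hDE hDl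
        (decoration_isAlgClosed (Γ := Γ) (X := X)) decoration_loopless
      exact ⟨e fun _ => true, he _⟩
    choose e he using hex
    have hreg := fun C : {C : Set D.End // IsRegularDClass C ∧
        ∀ H : Set D.End, H ⊆ C → IsGroupHClass H → IsIsomorphicToGroup H (Γ ≃g Γ)} =>
      C.2.1.exists_isIdempotentElem
    choose g _ hg using hreg
    refine mk_eq_continuum (fun x => ⟨{b | GreenD (e {n | x n = true}) b},
      ⟨_, (he _).isIdempotentElem.isRegularElt, rfl⟩, fun H hHC hH => ?_⟩) (fun x y h => ?_) g
      fun C C' h => Subtype.ext ((hg C).trans (h ▸ (hg C').symm))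
    -- The idempotent of `H` lies in the D-class, so its image is isomorphic to the decoration.
    · obtain ⟨f, hfH, hf, rfl⟩ := hH.exists_isIdempotentElem
      obtain ⟨θ⟩ := (he _).nonempty_relIso (splitsVia_image hf) (hHC hfH)
      exact ((splitsVia_image hf).of_relIso θ.symm).isIsomorphicToGroup.congr
        (decorationAut Γ _)
    · have h' : GreenD (e {n | x n = true}) (e {n | y n = true}) := by
        have := Set.ext_iff.1 (congrArg Subtype.val h) (e {n | y n = true})
        exact this.2 (GreenD.refl _)
      obtain ⟨θ⟩ := (he _).nonempty_relIso (he _) h'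
      have := eq_of_decoration_relIso θ
      exact funext fun n => Bool.eq_iff_iff.2 (Set.ext_iff.1 this n)
  · intro C hC
    obtain ⟨e, he, rfl⟩ := hC.exists_isIdempotentElem
    have hs := splitsVia_image he
    obtain ⟨f, hf, hfe⟩ := exists_injective_splitsVia hDE hDl
      (hs.isAlgClosed hDE.isAlgClosed) fun a => hDl a
    have hidem := fun H : {H : Set D.End // IsGroupHClass H ∧ H ⊆ {b | GreenD e b}} =>
      H.2.1.exists_isIdempotentElem
    choose g _ _ hg using hidem
    refine mk_eq_continuum (fun x => ⟨{b | GreenH (f x) b}, (hfe x).isGroupHClass,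
      fun b hb => (hs.greenD (hfe x)).trans_greenR hb.2⟩) (fun x y h => hf ?_) g
      fun H H' h => Subtype.ext ((hg H).trans (h ▸ (hg H').symm))
    have h' : GreenH (f x) (f y) := by
      have := Set.ext_iff.1 (congrArg Subtype.val h) (f y)
      exact this.2 (GreenH.refl _)
    exact h'.eq_of_isIdempotentElem (hfe x).isIdempotentElem (hfe y).isIdempotentElem
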